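/- Let $D=(V,A)$ be a finite digraph, let $f:A\to\mathbf Z\cup\{-\infty\}$ and $g:A\to\mathbf Z\cup\{+\infty\}$ satisfy $f\le g$, and let $m:V\to\mathbf Z$ satisfy $\sum_{v\in V}m(v)=0$. For bounds $(f,g)$ let $\overset{....}{Q}(f,g;m)$ denote the set of integer vectors $z\in\mathbf Z^A$ with $f\le z\le g$ such that, for every node $v$, the sum of $z$ over the edges entering $v$ minus the sum of $z$ over the edges leaving $v$ equals $m(v)$. For $F\subseteq A$ and a set $Q\subseteq\mathbf Z^A$, call $z\in Q$ an $F$-dec-min member of $Q$ if there is no $y\in Q$ such that the components of $y$ on $F$, arranged in decreasing order, form a sequence that is lexicographically smaller than the sequence formed in the same way from $z$. Let $F\subseteq A$ be a non-empty set on which $f$ and $g$ are finite and such that $f(e)<g(e)$ for every $e\in F$. Let $\beta:=\max\{g(e): e\in F\}$, let $L:=\{e\in F: g(e)=\beta\}$ and $g^-:=g-\chi_L$, where $\chi_L$ is the characteristic function of $L$. Assume that $\overset{....}{Q}(f,g;m)$ is non-empty and that $\overset{....}{Q}(f,g^-;m)$ is empty (so that $\beta$ is the smallest possible value of $\max\{z(e):e\in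 F\}$ over $z\in\overset{....}{Q}(f,g;m)$). Then there are functions $f':A\to\mathbf Z\cup\{-\infty\}$ and $g':A\to\mathbf Z\cup\{+\infty\}$ with $f\le f'\le g'\le g$ and a proper subset $F'\subset F$ such that an element $z$ of $\overset{....}{Q}(f,g;m)$ is an $F$-dec-min member of $\overset{....}{Q}(f,g;m)$ if and only if $z$ is an $F'$-dec-min member of $\overset{....}{Q}(f',g';m)$. In addition, $f'$ and $g'$ are finite on $F-F'$ and $0\le g'(e)-f'(e)\le 1$ holds for every $e\in F-F'$. -/

import Mathlib

/-- A directed graph with node set `V` and edge set `A`, parallel edges being allowed: the edge `e`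
goes from `tail e` to `head e`. -/
structure FlowDigraph (V A : Type*) where
  tail : A → V
  head : A → V

namespace FlowDigraph

variable {V A : Type*}

/-- The order between a lower bound in `ℤ ∪ {-∞}` and an upper bound in `ℤ ∪ {+∞}`, both being
regarded as elements of `ℤ ∪ {-∞, +∞}`. -/
def BoundLE (a : WithBot ℤ) (b : WithTop ℤ) : Prop :=
  WithBot.map (fun k : ℤ => (k : WithTop ℤ)) a ≤ (b : WithBot (WithTop ℤ))

/-- The edge `e` is tight: the lower and the upper bound coincide. -/
def IsTight (f : A → WithBot ℤ) (g : A → WithTop ℤ) (e : A) : Prop :=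
  ∃ k : ℤ, f e = (k : WithBot ℤ) ∧ g e = (k : WithTop ℤ)

/-- Total value of `x` on the edges entering the node `v`. -/
def inflow [Fintype A] [DecidableEq V] (D : FlowDigraph V A) (x : A → ℤ) (v : V) : ℤ :=
  ∑ e with D.head e = v, x e

/-- Total value of `x` on the edges leaving the node `v`. -/
def outflow [Fintype A] [DecidableEq V] (D : FlowDigraph V A) (x : A → ℤ) (v : V) : ℤ :=
  ∑ e with D.tail e = v, x e

/-- The set of integer-valued `(f, g)`-bounded `m`-flows. -/
def intFlows [Fintype A] [DecidableEq V] (D : FlowDigraph V A)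
    (f : A → WithBot ℤ) (g : A → WithTop ℤ) (m : V → ℤ) : Set (A → ℤ) :=
  {z | (∀ v, D.inflow z v - D.outflow z v = m v) ∧
    ∀ e, f e ≤ (z e : WithBot ℤ) ∧ (z e : WithTop ℤ) ≤ g e}

/-- The components of `z` on `F`, with multiplicities, arranged in decreasing order. -/
def decSort (F : Finset A) (z : A → ℤ) : List ℤ :=
  (F.val.map z).sort (fun a b => b ≤ a)

/-- `y` is decreasingly smaller than `z` on `F`: the decreasing rearrangement of `y` on `F` is
lexicographically smaller than that of `z`. -/
def DecSmaller (F : Finset A) (y z : A → ℤ) : Prop :=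
  List.Lex (fun a b : ℤ => a < b) (decSort F y) (decSort F z)

/-- `z` is an `F`-dec-min member of `Q`. -/
def IsDecMin (F : Finset A) (Q : Set (A → ℤ)) (z : A → ℤ) : Prop :=
  z ∈ Q ∧ ∀ y ∈ Q, ¬ DecSmaller F y z

/-- The edges of `F` whose upper bound is `β`. -/
def maxEdges (F : Finset A) (g : A → WithTop ℤ) (β : ℤ) : Finset A :=
  {e ∈ F | g e = (β : WithTop ℤ)}

/-- The function `g - χ_L`. -/
def lowerBy [DecidableEq A] (g : A → WithTop ℤ) (L : Finset A) (e : A) : WithTop ℤ :=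
  if e ∈ L then (g e).map (fun k => k - 1) else g e

end FlowDigraph

/-!
Since the upper bounds on `F` cannot all be lowered below `β`, every flow takes the value `β`
somewhere on `F`, and a decreasingly minimal flow takes it as rarely as possible. The proof
describes the flows with the fewest values `β` by bounds. The number of these values is a separable
convex cost (`topCost`), and a flow `z` of minimum cost carries an integral potential `p`
(`exists_potential_of_min_cost`). Writing `δ e = p (head e) - p (tail e)`, the sum of `δ e * x e` is
the same for all flows `x`, so `x` has minimum cost if and only if each `x e` minimises
`topCost - δ e * x e` between its bounds. The minimisers on one edge form an interval, and the ends
of these intervals (`lowerFace`, `upperFace`) are the new bounds `f'` and `g'`.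

On an edge with upper bound `β` and `δ e ≥ 1` the new interval is contained in `{β - 1, β}`; these
edges are removed from `F`. On the remaining edges of `F` no flow within the new bounds takes the
value `β`. All flows within the new bounds therefore have the same number of values `β` on the
removed edges, hence the same multiset of values there, and the removed edges do not influence
comparisons. The decreasing order enters only through `decSmaller_iff`, which compares the
multiplicities at the largest value where they differ.

The potential is found without shortest paths (`exists_potential`): arcs are added one at a time,
and a violated arc is repaired by lowering the potential by one on a maximal set of nodes reachable
by tight arcs. If that set contains the tail of the violated arc, a negative balanced arc set
appears; in the residual graph of a minimum cost flow this is impossible, because augmenting along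
it would lower the cost.
-/

namespace FlowDigraph

/-! ### Potentials for arc weights -/

/-- One repair step for potentials. Suppose that `p` is feasible on `T` and violates the arc `b`.
Either `b` closes a negative balanced arc set with arcs that are tight for `p`, or the violation of
`b` can be decreased by one while feasibility on `T` is maintained. -/
theorem exists_potential_step {V B : Type*} [Fintype V] [DecidableEq V] [DecidableEq B]
    (s t : B → V) (w : B → ℤ) (T : Finset B) (b : B) (hb : b ∉ T)
    (h : ∀ S ⊆ insert b T, (∀ φ : V → ℤ, ∑ a ∈ S, (φ (t a) - φ (s a)) = 0) → 0 ≤ ∑ a ∈ S, w a)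
    (p : V → ℤ) (hp : ∀ a ∈ T, p (t a) - p (s a) ≤ w a) (hviol : w b < p (t b) - p (s b)) :
    ∃ q : V → ℤ, (∀ a ∈ T, q (t a) - q (s a) ≤ w a) ∧
      q (t b) - q (s b) = p (t b) - p (s b) - 1 := by
  classical
  -- `P W` says that every node of `W` is the end of a unit flow from `t b`
  -- carried by tight arcs with heads in `W`.
  let P : Finset V → Prop := fun W => ∀ v ∈ W, ∃ S ⊆ T,
    (∀ a ∈ S, p (t a) - p (s a) = w a ∧ t a ∈ W) ∧
      ∀ φ : V → ℤ, ∑ a ∈ S, (φ (t a) - φ (s a)) = φ v - φ (t b)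
  have hP0 : P {t b} := by
    intro v hv
    rw [Finset.mem_singleton] at hv
    exact ⟨∅, by simp, by simp, by simp [hv]⟩
  obtain ⟨W, hW0, hWP, hWmax⟩ : ∃ W : Finset V, t b ∈ W ∧ P W ∧
      ∀ W' : Finset V, W ⊆ W' → P W' → W' ⊆ W := by
    obtain ⟨W, hW, hmax⟩ := (Set.toFinite {W : Finset V | P W}).exists_le_maximal hP0
    exact ⟨W, hW (by simp), hmax.1, fun W' h1 h2 => hmax.2 h2 h1⟩
  have hclosed : ∀ a ∈ T, p (t a) - p (s a) = w a → s a ∈ W → t a ∈ W := by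
    intro a ha htight hs
    by_contra hnot
    refine hnot (hWmax (insert (t a) W) (Finset.subset_insert _ _) ?_ (Finset.mem_insert_self _ _))
    intro v hv
    rcases Finset.mem_insert.1 hv with rfl | hv
    · obtain ⟨S, hST, hS, hφ⟩ := hWP _ hs
      have haS : a ∉ S := fun hh => hnot (hS a hh).2
      refine ⟨insert a S, Finset.insert_subset ha hST, ?_, ?_⟩
      · intro a' ha'
        rcases Finset.mem_insert.1 ha' with rfl | ha'
        · exact ⟨htight, Finset.mem_insert_self _ _⟩
        · exact ⟨(hS a' ha').1, Finset.mem_insert_of_mem (hS a' ha').2⟩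
      · intro φ
        rw [Finset.sum_insert haS, hφ]
        ring
    · obtain ⟨S, hST, hS, hφ⟩ := hWP _ hv
      exact ⟨S, hST, fun a' ha' => ⟨(hS a' ha').1, Finset.mem_insert_of_mem (hS a' ha').2⟩, hφ⟩
  have hsb : s b ∉ W := by
    intro hs
    obtain ⟨S, hST, hS, hφ⟩ := hWP _ hs
    have hbS : b ∉ S := fun hh => hb (hST hh)
    have h1 := h (insert b S) (Finset.insert_subset_insert _ hST) (by
      intro φ
      rw [Finset.sum_insert hbS, hφ]
      ring)
    rw [Finset.sum_insert hbS, ← Finset.sum_congr rfl (fun a ha => (hS a ha).1), hφ] at h1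
    linarith
  refine ⟨fun v => if v ∈ W then p v - 1 else p v, ?_, ?_⟩
  · intro a ha
    have h1 := hp a ha
    have h2 := hclosed a ha
    by_cases hs : s a ∈ W <;> by_cases ht : t a ∈ W <;> simp only [hs, ht, if_true, if_false]
    · omega
    · have h3 : p (t a) - p (s a) ≠ w a := fun hh => ht (h2 hh hs)
      omega
    · omega
    · omega
  · simp only [hW0, hsb, if_true, if_false]
    omega

/-- If no balanced arc set has negative weight, then there is an integral feasible potential.
Balance of `S` is expressed by testing against all node functions. -/
theorem exists_potential {V B : Type*} [Fintype V] [DecidableEq V] [DecidableEq B]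
    (s t : B → V) (w : B → ℤ) (T : Finset B)
    (h : ∀ S ⊆ T, (∀ φ : V → ℤ, ∑ a ∈ S, (φ (t a) - φ (s a)) = 0) → 0 ≤ ∑ a ∈ S, w a) :
    ∃ p : V → ℤ, ∀ a ∈ T, p (t a) - p (s a) ≤ w a := by
  induction T using Finset.induction_on with
  | empty => exact ⟨0, by simp⟩
  | insert b T hb ih =>
    obtain ⟨p, hp⟩ := ih fun S hS => h S (hS.trans (Finset.subset_insert _ _))
    -- The violation `n` of the new arc is repaired one unit at a time.
    obtain ⟨n, hn⟩ : ∃ n : ℕ, p (t b) - p (s b) ≤ w b + n :=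
      ⟨(p (t b) - p (s b) - w b).toNat, by omega⟩
    induction n generalizing p with
    | zero => exact ⟨p, Finset.forall_mem_insert _ _ _ |>.2 ⟨by simpa using hn, hp⟩⟩
    | succ n ihn =>
      by_cases hv : w b < p (t b) - p (s b)
      · obtain ⟨q, hq, hqb⟩ := exists_potential_step s t w T b hb h p hp hv
        exact ihn q hq (by push_cast at hn; omega)
      · exact ⟨p, Finset.forall_mem_insert _ _ _ |>.2 ⟨not_lt.1 hv, hp⟩⟩

/-! ### Optimality criterion for flows of minimum separable convex cost -/

section Flows

variable {V A : Type*} [Fintype V] [DecidableEq V] [Fintype A]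

/-- Summation by parts: the pairing of a node function with the net inflow. -/
theorem sum_mul_inflow_sub_outflow (D : FlowDigraph V A) (x : A → ℤ) (φ : V → ℤ) :
    ∑ v, φ v * (D.inflow x v - D.outflow x v) = ∑ e, (φ (D.head e) - φ (D.tail e)) * x e := by
  have key : ∀ k : A → V, ∑ v, φ v * ∑ e with k e = v, x e = ∑ e, φ (k e) * x e := by
    intro k
    rw [← Finset.sum_fiberwise (s := Finset.univ) (g := k)]
    refine Finset.sum_congr rfl fun v _ => ?_
    rw [Finset.mul_sum]
    refine Finset.sum_congr rfl fun e he => ?_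
    rw [(Finset.mem_filter.1 he).2]
  simp only [mul_sub, sub_mul, Finset.sum_sub_distrib, inflow, outflow, key]

/-- A vector satisfies the conservation law as soon as it pairs correctly with all node
functions. -/
theorem inflow_sub_outflow_eq_of_forall (D : FlowDigraph V A) (x : A → ℤ) (m : V → ℤ)
    (h : ∀ φ : V → ℤ, ∑ e, (φ (D.head e) - φ (D.tail e)) * x e = ∑ v, φ v * m v) (v : V) :
    D.inflow x v - D.outflow x v = m v := by
  have h1 := h (Pi.single v 1)
  rw [← sum_mul_inflow_sub_outflow] at h1
  simpa [Pi.single_apply] using h1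

/-- A flow of minimum separable convex cost admits an integral potential that certifies its
optimality: no residual arc has negative reduced cost. A residual arc is a pair `(e, d)`, where `d`
tells whether the value on `e` is increased (`true`) or decreased (`false`). -/
theorem exists_potential_of_min_cost (D : FlowDigraph V A)
    (f : A → WithBot ℤ) (g : A → WithTop ℤ) (m : V → ℤ) (c : A → ℤ → ℤ)
    (hc : ∀ e x, 2 * c e x ≤ c e (x + 1) + c e (x - 1))
    (z : A → ℤ) (hz : z ∈ D.intFlows f g m)
    (hmin : ∀ y ∈ D.intFlows f g m, ∑ e, c e (z e) ≤ ∑ e, c e (y e)) :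
    ∃ p : V → ℤ, ∀ e,
      (((z e + 1 : ℤ) : WithTop ℤ) ≤ g e →
        p (D.head e) - p (D.tail e) ≤ c e (z e + 1) - c e (z e)) ∧
      (f e ≤ ((z e - 1 : ℤ) : WithBot ℤ) →
        p (D.tail e) - p (D.head e) ≤ c e (z e - 1) - c e (z e)) := by
  classical
  let s : A × Bool → V := fun a => if a.2 then D.tail a.1 else D.head a.1
  let t : A × Bool → V := fun a => if a.2 then D.head a.1 else D.tail a.1
  let w : A × Bool → ℤ := fun a =>
    if a.2 then c a.1 (z a.1 + 1) - c a.1 (z a.1) else c a.1 (z a.1 - 1) - c a.1 (z a.1)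
  let T : Finset (A × Bool) := Finset.univ.filter fun a =>
    if a.2 then ((z a.1 + 1 : ℤ) : WithTop ℤ) ≤ g a.1 else f a.1 ≤ ((z a.1 - 1 : ℤ) : WithBot ℤ)
  have hsum : ∀ (S : Finset (A × Bool)) (r : A × Bool → ℤ), ∑ a ∈ S, r a =
      ∑ e, ((if (e, true) ∈ S then r (e, true) else 0) +
        (if (e, false) ∈ S then r (e, false) else 0)) := by
    intro S r
    rw [← Finset.univ_inter S, ← Finset.sum_ite_mem, Fintype.sum_prod_type]
    simp
  have hTt : ∀ e, (e, true) ∈ T ↔ ((z e + 1 : ℤ) : WithTop ℤ) ≤ g e := fun e => by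
    simp only [T, Finset.mem_filter, Finset.mem_univ, true_and, if_true]
  have hTf : ∀ e, (e, false) ∈ T ↔ f e ≤ ((z e - 1 : ℤ) : WithBot ℤ) := fun e => by
    simp only [T, Finset.mem_filter, Finset.mem_univ, true_and, Bool.false_eq_true, if_false]
  have hpot : ∃ p : V → ℤ, ∀ a ∈ T, p (t a) - p (s a) ≤ w a := by
    refine exists_potential s t w T fun S hST hbal => ?_
    let y : A → ℤ := fun e => z e + ((if (e, true) ∈ S then 1 else 0) -
      (if (e, false) ∈ S then 1 else 0))
    have hy : y ∈ D.intFlows f g m := by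
      refine ⟨inflow_sub_outflow_eq_of_forall D y m fun φ => ?_, fun e => ?_⟩
      · have h1 := hbal φ
        rw [hsum] at h1
        have h2 := sum_mul_inflow_sub_outflow D z φ
        simp only [hz.1] at h2
        rw [h2, ← add_zero (∑ e, (φ (D.head e) - φ (D.tail e)) * z e), ← h1,
          ← Finset.sum_add_distrib]
        refine Finset.sum_congr rfl fun e _ => ?_
        simp only [y, s, t, if_true, Bool.false_eq_true, if_false]
        split_ifs <;> ring
      · have h0 := hz.2 e
        have h1 : (e, true) ∈ S → ((z e + 1 : ℤ) : WithTop ℤ) ≤ g e := fun hh =>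
          (hTt e).1 (hST hh)
        have h2 : (e, false) ∈ S → f e ≤ ((z e - 1 : ℤ) : WithBot ℤ) := fun hh =>
          (hTf e).1 (hST hh)
        by_cases ht : (e, true) ∈ S <;> by_cases hf : (e, false) ∈ S <;>
          simp only [y, ht, hf, if_true, if_false]
        · simpa using h0
        · refine ⟨h0.1.trans (WithBot.coe_le_coe.2 (by omega)), ?_⟩
          simpa using h1 ht
        · refine ⟨by simpa [sub_eq_add_neg] using h2 hf,
            (WithTop.coe_le_coe.2 (by omega)).trans h0.2⟩
        · simpa using h0
    have hcost := hmin y hy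
    have : ∑ e, (c e (y e) - c e (z e)) ≤ ∑ a ∈ S, w a := by
      rw [hsum]
      refine Finset.sum_le_sum fun e _ => ?_
      have := hc e (z e)
      -- Convexity is needed when both residual arcs of `e` occur: they cancel in `y`.
      by_cases ht : (e, true) ∈ S <;> by_cases hf : (e, false) ∈ S <;>
        simp [y, w, ht, hf] <;> first | linarith | simp [sub_eq_add_neg]
    rw [Finset.sum_sub_distrib] at this
    linarith
  obtain ⟨p, hp⟩ := hpot
  refine ⟨p, fun e => ⟨fun hh => ?_, fun hh => ?_⟩⟩
  · simpa [s, t, w] using hp (e, true) ((hTt e).2 hh)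
  · simpa [s, t, w] using hp (e, false) ((hTf e).2 hh)

end Flows

/-! ### The decreasing order through multiplicities -/

/-- A decreasing list that is lexicographically smaller than another one has fewer copies of the
largest value whose multiplicities differ. -/
theorem exists_count_lt_of_lex {l₁ l₂ : List ℤ} (h : List.Lex (fun a b : ℤ => a < b) l₁ l₂)
    (h₁ : l₁.Pairwise (fun a b => b ≤ a)) (h₂ : l₂.Pairwise (fun a b => b ≤ a)) :
    ∃ b, l₁.count b < l₂.count b ∧ ∀ c, b < c → l₁.count c = l₂.count c := by
  induction h with
  | @nil a l =>
    refine ⟨a, by simp, fun c hc => ?_⟩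
    rw [List.count_nil, eq_comm, List.count_eq_zero, List.mem_cons]
    rintro (rfl | hm)
    · exact lt_irrefl _ hc
    · exact absurd ((List.pairwise_cons.1 h₂).1 c hm) (not_le.2 hc)
  | @cons a l₁ l₂ _ ih =>
    obtain ⟨b, hb, hc⟩ := ih (List.pairwise_cons.1 h₁).2 (List.pairwise_cons.1 h₂).2
    refine ⟨b, by simpa [List.count_cons] using hb, fun c hbc => ?_⟩
    simp [List.count_cons, hc c hbc]
  | @rel a₁ l₁ a₂ l₂ hlt =>
    have key : ∀ c, a₂ ≤ c → (a₁ :: l₁).count c = 0 := by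
      intro c hc
      rw [List.count_eq_zero, List.mem_cons]
      rintro (rfl | hm)
      · omega
      · have := (List.pairwise_cons.1 h₁).1 c hm
        omega
    refine ⟨a₂, by rw [key a₂ le_rfl]; simp, fun c hc => ?_⟩
    rw [key c hc.le, eq_comm, List.count_eq_zero, List.mem_cons]
    rintro (rfl | hm)
    · omega
    · have := (List.pairwise_cons.1 h₂).1 c hm
      omega

section Dec

variable {A : Type*}

/-- The number of edges of `F` on which `x` takes the value `b`. -/
def mult (F : Finset A) (x : A → ℤ) (b : ℤ) : ℕ := ∑ e ∈ F, if x e = b then 1 else 0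

theorem count_decSort (F : Finset A) (x : A → ℤ) (b : ℤ) :
    (decSort F x).count b = mult F x b := by
  rw [decSort, ← Multiset.coe_count, Multiset.sort_eq, Multiset.count_map, mult,
    Finset.sum_boole, ← Finset.filter_val, Finset.card_val]
  simp [eq_comm]

/-- `y` is decreasingly smaller than `z` if and only if, at the largest value whose multiplicities
differ, the multiplicity in `y` is the smaller one. -/
theorem decSmaller_iff (F : Finset A) (y z : A → ℤ) :
    DecSmaller F y z ↔ ∃ b, mult F y b < mult F z b ∧ ∀ c, b < c → mult F y c = mult F z c := by
  have hs : ∀ x : A → ℤ, (decSort F x).Pairwise (fun a b => b ≤ a) := fun x =>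
    Multiset.pairwise_sort _ _
  have fwd : ∀ y z : A → ℤ, DecSmaller F y z →
      ∃ b, mult F y b < mult F z b ∧ ∀ c, b < c → mult F y c = mult F z c := by
    intro y z h
    simpa only [count_decSort] using exists_count_lt_of_lex h (hs y) (hs z)
  refine ⟨fwd y z, ?_⟩
  rintro ⟨b, hb, hbc⟩
  rcases trichotomous_of (List.Lex (fun a b : ℤ => a < b)) (decSort F y) (decSort F z) with
    h | h | h
  · exact h
  · rw [← count_decSort, ← count_decSort, h] at hb
    exact absurd hb (lt_irrefl _)
  · obtain ⟨b', hb', hbc'⟩ := fwd z y h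
    rcases lt_trichotomy b b' with hlt | rfl | hlt
    · exact absurd (hbc b' hlt) hb'.ne'
    · exact absurd hb (not_lt.2 hb'.le)
    · exact absurd (hbc' b hlt) hb.ne'

/-- Edges outside `F'` can be dropped from the comparison of vectors with equal multiplicities
there. -/
theorem decSmaller_iff_of_mult_sdiff_eq [DecidableEq A] {F F' : Finset A} (hF : F' ⊆ F)
    {y z : A → ℤ} (h : ∀ b, mult (F \ F') y b = mult (F \ F') z b) :
    DecSmaller F y z ↔ DecSmaller F' y z := by
  have hsplit : ∀ (x : A → ℤ) b, mult F x b = mult (F \ F') x b + mult F' x b := fun x b =>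
    (Finset.sum_sdiff hF).symm
  simp only [decSmaller_iff, hsplit, h, add_lt_add_iff_left, add_right_inj]

theorem mult_eq_zero {F : Finset A} {x : A → ℤ} {b : ℤ} (h : ∀ e ∈ F, x e ≠ b) :
    mult F x b = 0 :=
  Finset.sum_eq_zero fun e he => if_neg (h e he)

/-- A vector with the two values `β - 1` and `β` has its multiplicities determined by that
of `β`. -/
theorem mult_eq_of_two_values {F : Finset A} {y z : A → ℤ} {β : ℤ}
    (hy : ∀ e ∈ F, y e = β - 1 ∨ y e = β) (hz : ∀ e ∈ F, z e = β - 1 ∨ z e = β)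
    (h : mult F y β = mult F z β) (b : ℤ) : mult F y b = mult F z b := by
  have hcard : ∀ x : A → ℤ, (∀ e ∈ F, x e = β - 1 ∨ x e = β) →
      mult F x (β - 1) + mult F x β = F.card := by
    intro x hx
    rw [mult, mult, ← Finset.sum_add_distrib, Finset.card_eq_sum_ones]
    refine Finset.sum_congr rfl fun e he => ?_
    have : β ≠ β - 1 := by omega
    rcases hx e he with h | h <;> simp [h, this]
  by_cases h1 : b = β
  · rw [h1, h]
  by_cases h2 : b = β - 1
  · have := hcard y hy
    have := hcard z hz
    rw [h2]
    omega
  rw [mult_eq_zero, mult_eq_zero]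
  · intro e he hh
    rcases hz e he with h3 | h3 <;> omega
  · intro e he hh
    rcases hy e he with h3 | h3 <;> omega

theorem decSmaller_of_mult_lt {F : Finset A} {y z : A → ℤ} {β : ℤ}
    (hy : ∀ e ∈ F, y e ≤ β) (hz : ∀ e ∈ F, z e ≤ β) (h : mult F y β < mult F z β) :
    DecSmaller F y z := by
  refine (decSmaller_iff F y z).2 ⟨β, h, fun c hc => ?_⟩
  rw [mult_eq_zero, mult_eq_zero]
  · exact fun e he => ((hz e he).trans_lt hc).ne
  · exact fun e he => ((hy e he).trans_lt hc).ne

theorem mult_le_of_decSmaller {F : Finset A} {y z : A → ℤ} {β : ℤ}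
    (hz : ∀ e ∈ F, z e ≤ β) (h : DecSmaller F y z) : mult F y β ≤ mult F z β := by
  obtain ⟨b, hb, hc⟩ := (decSmaller_iff F y z).1 h
  rcases lt_trichotomy b β with hlt | rfl | hlt
  · exact (hc β hlt).le
  · exact hb.le
  · rw [mult_eq_zero fun e he => ((hz e he).trans_lt hlt).ne] at hb
    exact absurd hb (Nat.not_lt_zero _)

end Dec

/-! ### The bounds cut out by the optimality criterion on one edge -/

/-- The cost of the value `x` on an edge; `top` says that the edge has the largest upper bound `β`.
On `x ≤ β` it is the indicator of `x = β`; beyond `β` it is continued so as to be convex. -/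
def topCost (top : Prop) [Decidable top] (β x : ℤ) : ℤ :=
  if top then max 0 (x - (β - 1)) else 0

/-- Lower end of the set of minimisers of `topCost top β x - δ * x` subject to the lower bound `l`,
where `z` is known to be one of the minimisers. -/
def lowerFace (top : Prop) [Decidable top] (l : WithBot ℤ) (β z δ : ℤ) : WithBot ℤ :=
  if δ = 0 then l else if top ∧ δ = 1 then ((β - 1 : ℤ) : WithBot ℤ) else (z : WithBot ℤ)

/-- Upper end of the set of minimisers of `topCost top β x - δ * x` subject to the upper bound `u`,
where `z` is known to be one of the minimisers. -/
def upperFace (top : Prop) [Decidable top] (u : WithTop ℤ) (β z δ : ℤ) : WithTop ℤ :=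
  if δ = 0 then (if top then ((β - 1 : ℤ) : WithTop ℤ) else u)
  else if top ∧ δ = 1 then (β : WithTop ℤ) else (z : WithTop ℤ)

theorem boundLE_coe {a b : ℤ} (h : a ≤ b) : BoundLE (a : WithBot ℤ) (b : WithTop ℤ) :=
  WithBot.coe_le_coe.2 (WithTop.coe_le_coe.2 h)

section Edge

variable {top : Prop} [Decidable top] {l : WithBot ℤ} {u : WithTop ℤ} {β z δ : ℤ}

theorem le_lowerFace (hl : l ≤ z) (htop : top → u = β ∧ l ≤ ((β - 1 : ℤ) : WithBot ℤ)) :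
    l ≤ lowerFace top l β z δ := by
  rw [lowerFace]
  split_ifs with h1 h2
  · exact le_rfl
  · exact (htop h2.1).2
  · exact hl

theorem upperFace_le (hu : z ≤ u) (htop : top → u = β ∧ l ≤ ((β - 1 : ℤ) : WithBot ℤ)) :
    upperFace top u β z δ ≤ u := by
  rw [upperFace]
  split_ifs with h1 h2 h3
  · rw [(htop h2).1]
    exact WithTop.coe_le_coe.2 (by omega)
  · exact le_rfl
  · exact (htop h3.1).1.ge
  · exact hu

theorem boundLE_faces (hlu : BoundLE l u) (htop : top → u = β ∧ l ≤ ((β - 1 : ℤ) : WithBot ℤ)) :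
    BoundLE (lowerFace top l β z δ) (upperFace top u β z δ) := by
  rw [lowerFace, upperFace]
  split_ifs with h1 h2 h3
  · have h := (htop h2).2
    cases l with
    | bot => exact bot_le
    | coe a => exact boundLE_coe (WithBot.coe_le_coe.1 h)
  · exact hlu
  · exact boundLE_coe (by omega)
  · exact boundLE_coe le_rfl

/-- If no unit step from `z` within the bounds decreases `topCost top β x - δ * x`, then `z`
minimises this function between the bounds, and its minimisers are the integers between
`lowerFace` and `upperFace`. -/
theorem topCost_sub_le_and_eq_iff (hu : z ≤ u)
    (htop : top → u = β ∧ l ≤ ((β - 1 : ℤ) : WithBot ℤ))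
    (hup : ((z + 1 : ℤ) : WithTop ℤ) ≤ u → δ ≤ topCost top β (z + 1) - topCost top β z)
    (hdown : l ≤ ((z - 1 : ℤ) : WithBot ℤ) → -δ ≤ topCost top β (z - 1) - topCost top β z)
    {x : ℤ} (hlx : l ≤ x) (hxu : x ≤ u) :
    topCost top β z - δ * z ≤ topCost top β x - δ * x ∧
      (topCost top β z - δ * z = topCost top β x - δ * x ↔
        lowerFace top l β z δ ≤ x ∧ x ≤ upperFace top u β z δ) := by
  have hup' : z + 1 ≤ x → δ ≤ topCost top β (z + 1) - topCost top β z := fun h =>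
    hup ((WithTop.coe_le_coe.2 h).trans hxu)
  have hdown' : x ≤ z - 1 → -δ ≤ topCost top β (z - 1) - topCost top β z := fun h =>
    hdown (hlx.trans (WithBot.coe_le_coe.2 h))
  have hprod : δ * x = δ * z + δ * (x - z) := by ring
  have hpos : ∀ k : ℤ, k ≤ δ → x ≤ z → δ * (x - z) ≤ k * (x - z) := fun k hk hx =>
    mul_le_mul_of_nonpos_right hk (by omega)
  have hneg : ∀ k : ℤ, δ ≤ k → z ≤ x → δ * (x - z) ≤ k * (x - z) := fun k hk hx =>
    mul_le_mul_of_nonneg_right hk (by omega)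
  have heq : x = z → δ * (x - z) = 0 := fun h => by rw [h]; simp
  by_cases ht : top
  · obtain ⟨hu', hl'⟩ := htop ht
    have hzβ : z ≤ β := by rw [hu'] at hu; exact WithTop.coe_le_coe.1 hu
    have hxβ : x ≤ β := by rw [hu'] at hxu; exact WithTop.coe_le_coe.1 hxu
    have hup'' : z + 1 ≤ β → δ ≤ topCost top β (z + 1) - topCost top β z := fun h =>
      hup (by rw [hu']; exact WithTop.coe_le_coe.2 h)
    have hdown'' : z = β → -δ ≤ topCost top β (z - 1) - topCost top β z := fun h =>
      hdown (by rw [h]; exact hl')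
    simp only [topCost, ht, if_true, true_and, lowerFace, upperFace] at *
    rcases lt_trichotomy δ 0 with hδ | rfl | hδ
    · have h := hneg (-1) (by omega)
      rw [if_neg hδ.ne, if_neg (by omega), if_neg hδ.ne, if_neg (by omega)]
      rw [WithBot.coe_le_coe, WithTop.coe_le_coe]
      omega
    · simp only [if_true, hlx, true_and, WithTop.coe_le_coe]
      omega
    · rw [if_neg hδ.ne', if_neg hδ.ne']
      by_cases h1 : δ = 1
      · subst h1
        simp only [if_true, WithBot.coe_le_coe, WithTop.coe_le_coe]
        omega
      · have h := hpos 2 (by omega)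
        rw [if_neg h1, if_neg h1, WithBot.coe_le_coe, WithTop.coe_le_coe]
        omega
  · simp only [topCost, ht, if_false, false_and, lowerFace, upperFace] at *
    rcases lt_trichotomy δ 0 with hδ | rfl | hδ
    · have h := hneg (-1) (by omega)
      rw [if_neg hδ.ne, if_neg hδ.ne, WithBot.coe_le_coe, WithTop.coe_le_coe]
      omega
    · simp [hlx, hxu]
    · have h := hpos 1 (by omega)
      rw [if_neg hδ.ne', if_neg hδ.ne', WithBot.coe_le_coe, WithTop.coe_le_coe]
      omega

end Edge

end FlowDigraph

open FlowDigraph in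
theorem mainTheorem7 {V A : Type*} [Fintype V] [DecidableEq V] [Fintype A] [DecidableEq A]
    (D : FlowDigraph V A)
    (f : A → WithBot ℤ) (g : A → WithTop ℤ) (hfg : ∀ e, FlowDigraph.BoundLE (f e) (g e))
    (m : V → ℤ) (hm : ∑ v, m v = 0)
    (F : Finset A) (hfin : ∀ e ∈ F, f e ≠ ⊥ ∧ g e ≠ ⊤)
    (hF : F.Nonempty) (htight : ∀ e ∈ F, ¬ FlowDigraph.IsTight f g e)
    (β : ℤ) (hβ : IsGreatest (g '' (F : Set A)) (β : WithTop ℤ))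
    (hQ : (D.intFlows f g m).Nonempty)
    (hQempty : D.intFlows f
      (FlowDigraph.lowerBy g (FlowDigraph.maxEdges F g β)) m = ∅) :
    ∃ (f' : A → WithBot ℤ) (g' : A → WithTop ℤ) (F' : Finset A),
      (∀ e, f e ≤ f' e ∧ FlowDigraph.BoundLE (f' e) (g' e) ∧ g' e ≤ g e) ∧
      F' ⊂ F ∧
      (∀ z ∈ D.intFlows f g m,
        FlowDigraph.IsDecMin F (D.intFlows f g m) z ↔
          FlowDigraph.IsDecMin F' (D.intFlows f' g' m) z) ∧
      (∀ e ∈ F \ F', ∃ a b : ℤ, f' e = (a : WithBot ℤ) ∧ g' e = (b : WithTop ℤ) ∧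
        0 ≤ b - a ∧ b - a ≤ 1) := by
  classical
  set Q := D.intFlows f g m with hQdef
  set L := maxEdges F g β with hLdef
  have hmemL : ∀ e, e ∈ L ↔ e ∈ F ∧ g e = (β : WithTop ℤ) := fun e => by
    simp [hLdef, maxEdges]
  have htop : ∀ e, e ∈ L → g e = β ∧ f e ≤ ((β - 1 : ℤ) : WithBot ℤ) := by
    intro e he
    obtain ⟨heF, hge⟩ := (hmemL e).1 he
    refine ⟨hge, ?_⟩
    obtain ⟨a, ha⟩ := WithBot.ne_bot_iff_exists.1 (hfin e heF).1
    have h1 := hfg e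
    rw [← ha, hge] at h1
    have h2 : a ≤ β := WithTop.coe_le_coe.1 (WithBot.coe_le_coe.1 h1)
    have h3 : a ≠ β := by
      rintro rfl
      exact htight e heF ⟨a, ha.symm, hge⟩
    rw [← ha]
    exact WithBot.coe_le_coe.2 (by omega)
  have hleβ : ∀ x ∈ Q, ∀ e ∈ F, x e ≤ β := fun x hx e he =>
    WithTop.coe_le_coe.1 ((hx.2 e).2.trans (hβ.2 ⟨e, he, rfl⟩))
  have hβL : ∀ x ∈ Q, ∀ e ∈ F, x e = β → e ∈ L := fun x hx e he h =>
    (hmemL e).2 ⟨he, le_antisymm (hβ.2 ⟨e, he, rfl⟩) (h ▸ (hx.2 e).2)⟩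
  have hcost : ∀ x ∈ Q, ∑ e, topCost (e ∈ L) β (x e) = mult F x β := by
    intro x hx
    rw [mult, Nat.cast_sum, ← Finset.sum_subset (Finset.subset_univ F)]
    · refine Finset.sum_congr rfl fun e he => ?_
      have h1 := hleβ x hx e he
      have h2 := hβL x hx e he
      by_cases heL : e ∈ L <;> by_cases hxe : x e = β <;> simp [topCost, heL, hxe]
      · omega
      · exact heL (h2 hxe)
    · intro e _ he
      exact if_neg fun h => he ((hmemL e).1 h).1
  obtain ⟨z, hz, hzmin⟩ := (measure fun x : A → ℤ => mult F x β).wf.has_min Q hQ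
  replace hzmin : ∀ y ∈ Q, mult F z β ≤ mult F y β := fun y hy => not_lt.1 (hzmin y hy)
  obtain ⟨p, hp⟩ := exists_potential_of_min_cost D f g m (fun e => topCost (e ∈ L) β)
    (fun e x => by simp only [topCost]; split_ifs <;> omega) z hz
    (fun y hy => by
      rw [hcost y hy, hcost z hz]
      exact_mod_cast hzmin y hy)
  set δ : A → ℤ := fun e => p (D.head e) - p (D.tail e) with hδ
  -- Each `z e` minimises the reduced cost on its edge, and the new bounds are those of the face of
  -- all minimisers.
  have hedge := fun (e : A) (x : ℤ) =>
    topCost_sub_le_and_eq_iff (x := x) (δ := δ e) (hz.2 e).2 (htop e) (hp e).1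
      (fun h => by simpa [hδ] using (hp e).2 h)
  set f' : A → WithBot ℤ := fun e => lowerFace (e ∈ L) (f e) β (z e) (δ e) with hf'
  set g' : A → WithTop ℤ := fun e => upperFace (e ∈ L) (g e) β (z e) (δ e) with hg'
  -- The edges that leave `F` are those on which the new bounds allow only `β - 1` and `β`.
  set F' : Finset A := {e ∈ F | ¬ (e ∈ L ∧ 1 ≤ δ e)} with hF'
  have hff' : ∀ e, f e ≤ f' e := fun e => le_lowerFace (hz.2 e).1 (htop e)
  have hgg' : ∀ e, g' e ≤ g e := fun e => upperFace_le (hz.2 e).2 (htop e)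
  -- The flows between the new bounds are the flows that take the value `β` on `F` least often.
  have hmem : ∀ x, x ∈ D.intFlows f' g' m ↔ x ∈ Q ∧ mult F x β = mult F z β := by
    intro x
    -- The potential part of the reduced cost is the same for all flows, so a flow has minimum cost
    -- exactly if it attains the minimum of the reduced cost on every edge.
    have key : x ∈ Q → (mult F x β = mult F z β ↔
        ∀ e, f' e ≤ x e ∧ (x e : WithTop ℤ) ≤ g' e) := by
      intro hx
      have h1 : ∑ e, δ e * z e = ∑ e, δ e * x e := by
        rw [hδ, ← sum_mul_inflow_sub_outflow, ← sum_mul_inflow_sub_outflow]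
        simp only [hx.1, hz.1]
      have h2 := Finset.sum_eq_sum_iff_of_le (s := Finset.univ)
        fun e _ => (hedge e (x e) (hx.2 e).1 (hx.2 e).2).1
      rw [Finset.sum_sub_distrib, Finset.sum_sub_distrib, h1, sub_left_inj, hcost z hz,
        hcost x hx, Nat.cast_inj, eq_comm] at h2
      rw [h2]
      refine forall_congr' fun e => ?_
      rw [(hedge e (x e) (hx.2 e).1 (hx.2 e).2).2]
      simp [hf', hg']
    constructor
    · intro hx
      have hxQ : x ∈ Q :=
        ⟨hx.1, fun e => ⟨(hff' e).trans (hx.2 e).1, (hx.2 e).2.trans (hgg' e)⟩⟩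
      exact ⟨hxQ, (key hxQ).2 hx.2⟩
    · exact fun hx => ⟨hx.1.1, (key hx.1).1 hx.2⟩
  have hsdiff : ∀ e, e ∈ F \ F' ↔ e ∈ L ∧ 1 ≤ δ e := by
    intro e
    rw [hF', Finset.mem_sdiff, Finset.mem_filter]
    have := hmemL e
    tauto
  have hgap : ∀ e ∈ F \ F', ∃ a b : ℤ, f' e = (a : WithBot ℤ) ∧ g' e = (b : WithTop ℤ) ∧
      0 ≤ b - a ∧ b - a ≤ 1 := by
    intro e he
    obtain ⟨heL, hδe⟩ := (hsdiff e).1 he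
    by_cases h1 : δ e = 1
    · exact ⟨β - 1, β, by simp [hf', lowerFace, heL, h1], by simp [hg', upperFace, heL, h1],
        by omega, by omega⟩
    · have h0 : δ e ≠ 0 := by omega
      exact ⟨z e, z e, by simp [hf', lowerFace, h0, h1], by simp [hg', upperFace, h0, h1],
        by omega, by omega⟩
  have hF'β : ∀ x ∈ D.intFlows f' g' m, ∀ e ∈ F', x e ≠ β := by
    intro x hx e he hxe
    obtain ⟨heF, hne⟩ := Finset.mem_filter.1 he
    have heL := hβL x ((hmem x).1 hx).1 e heF hxe
    have hδe : δ e ≤ 0 := by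
      by_contra h
      exact hne ⟨heL, by omega⟩
    have hxu := (hx.2 e).2
    rcases hδe.lt_or_eq with h | h
    · have hzx : β ≤ z e := by
        rw [← hxe]
        have h1 : δ e ≠ 1 := by omega
        simp only [hg', upperFace, h.ne, h1, and_false, if_false] at hxu
        exact WithTop.coe_le_coe.1 hxu
      have hzβ := hleβ z hz e heF
      have := (hp e).2 (by rw [le_antisymm hzβ hzx]; exact (htop e heL).2)
      simp only [topCost, heL, if_true] at this
      simp only [hδ] at h
      omega
    · have : x e ≤ β - 1 := by
        simp only [hg', upperFace, h, heL, if_true] at hxu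
        exact WithTop.coe_le_coe.1 hxu
      omega
  have hF'F : F' ⊆ F := Finset.filter_subset _ _
  have htwo : ∀ x ∈ D.intFlows f' g' m, ∀ e ∈ F \ F', x e = β - 1 ∨ x e = β := by
    intro x hx e he
    obtain ⟨heL, hδe⟩ := (hsdiff e).1 he
    have hxβ := hleβ x ((hmem x).1 hx).1 e (Finset.mem_sdiff.1 he).1
    have hzβ := hleβ z hz e (Finset.mem_sdiff.1 he).1
    have hxl := (hx.2 e).1
    by_cases h1 : δ e = 1
    · have : β - 1 ≤ x e := by
        simp only [hf', lowerFace, h1, heL, one_ne_zero, if_false, and_self, if_true] at hxl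
        exact WithBot.coe_le_coe.1 hxl
      omega
    · have hzx : z e ≤ x e := by
        have h0 : δ e ≠ 0 := by omega
        simp only [hf', lowerFace, h0, h1, and_false, if_false] at hxl
        exact WithBot.coe_le_coe.1 hxl
      have hzβ' : ¬ z e + 1 ≤ β := by
        intro h
        have := (hp e).1 (by rw [(htop e heL).1]; exact WithTop.coe_le_coe.2 h)
        simp only [topCost, heL, if_true] at this
        simp only [hδ] at h1 hδe
        omega
      omega
  have hmult : ∀ x ∈ D.intFlows f' g' m, ∀ y ∈ D.intFlows f' g' m, ∀ b,
      mult (F \ F') y b = mult (F \ F') x b := by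
    have hβeq : ∀ x ∈ D.intFlows f' g' m, mult (F \ F') x β = mult F z β := by
      intro x hx
      rw [← ((hmem x).1 hx).2]
      have h1 : mult (F \ F') x β + mult F' x β = mult F x β := Finset.sum_sdiff hF'F
      rw [← h1, mult_eq_zero (hF'β x hx), add_zero]
    exact fun x hx y hy => mult_eq_of_two_values (htwo y hy) (htwo x hx)
      ((hβeq y hy).trans (hβeq x hx).symm)
  have hzQ' : z ∈ D.intFlows f' g' m := (hmem z).2 ⟨hz, rfl⟩
  refine ⟨f', g', F', fun e => ⟨hff' e, boundLE_faces (hfg e) (htop e), hgg' e⟩, ?_, ?_, hgap⟩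
  · -- If `F' = F`, then `z` avoids the value `β` on `F` and so obeys the lowered upper bound.
    refine hF'F.ssubset_of_ne fun hEq => ?_
    rw [hEq] at hF'β
    refine (Set.eq_empty_iff_forall_notMem.1 hQempty) z ⟨hz.1, fun e => ⟨(hz.2 e).1, ?_⟩⟩
    rw [lowerBy]
    split_ifs with heL
    · have heF := ((hmemL e).1 heL).1
      have h1 := hF'β z hzQ' e heF
      have h2 := hleβ z hz e heF
      rw [(htop e heL).1]
      exact WithTop.coe_le_coe.2 (by change z e ≤ β - 1; omega)
    · exact (hz.2 e).2
  · intro x hx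
    constructor
    · rintro ⟨-, hxmin⟩
      have hxQ' : x ∈ D.intFlows f' g' m := by
        refine (hmem x).2 ⟨hx, le_antisymm (not_lt.1 fun hlt => ?_) (hzmin x hx)⟩
        exact hxmin z hz (decSmaller_of_mult_lt (hleβ z hz) (hleβ x hx) hlt)
      refine ⟨hxQ', fun y hy hyx => hxmin y ((hmem y).1 hy).1 ?_⟩
      exact (decSmaller_iff_of_mult_sdiff_eq hF'F (hmult x hxQ' y hy)).2 hyx
    · rintro ⟨hxQ', hxmin⟩
      refine ⟨hx, fun y hy hyx => ?_⟩
      have hyQ' : y ∈ D.intFlows f' g' m := by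
        refine (hmem y).2 ⟨hy, le_antisymm ?_ (hzmin y hy)⟩
        exact (mult_le_of_decSmaller (hleβ x hx) hyx).trans ((hmem x).1 hxQ').2.le
      exact hxmin y hyQ' ((decSmaller_iff_of_mult_sdiff_eq hF'F (hmult x hxQ' y hyQ')).1 hyx)
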